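/- Let $d \ge 0$ be an integer, let $\mathbb{N}_0^d$ be the set of multi-indices, with unit vectors $e_1, \dots, e_d$, and let $\partial\mathbb{B}^d = \{\zeta \in \mathbb{C}^d : |\zeta_1|^2 + \cdots + |\zeta_d|^2 = 1\}$ (the empty set if $d = 0$). Let $K : \mathbb{N}_0^d \times \mathbb{N}_0^d \to \mathbb{C}$ be a positive kernel, i.e. the matrices $[K(\alpha,\beta)]_{\alpha,\beta \in F}$ are positive semidefinite for all finite $F \subset \mathbb{N}_0^d$. Then there exists a finite positive Borel measure $\mu$ on $\partial\mathbb{B}^d$ with moment kernel $K$, i.e. such that \[ K(\alpha,\beta) = \int_{\partial\mathbb{B}^d} \zeta^{\alpha}\, \overline{\zeta}^{\beta} \, \mathrm{d}\mu(\zeta) \qquad \text{for all } \alpha, \beta \in \mathbb{N}_0^d, \] where $\zeta^{\alpha} = \zeta_1^{\alpha_1} \cdots \zeta_d^{\alpha_d}$ and $\overline{\zeta}^{\beta} = \overline{\zeta^{\beta}}$, if and only if \[ K(\alpha,\beta) = \sum_{j=1}^{d} K(\alpha + e_j, \beta + e_j) \qquad \text{for all } \alpha, \beta \in \mathbb{N}_0^d.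 \] -/

import Mathlib

open MeasureTheory
open scoped ComplexOrder ComplexConjugate

/-- A positive kernel on a set `ι`: the (possibly infinite) matrix `[K (α, β)]` is positive
semidefinite, that is, it is Hermitian and the sum of `conj (c α) * K (α, β) * c β` over all
`α`, `β` is real and nonnegative for every finitely supported family `c` of complex numbers. -/
def IsPositiveKernel {ι : Type*} (K : ι → ι → ℂ) : Prop :=
  (Matrix.of K).PosSemidef

/-- The unit sphere of `ℂ ^ d` for the Euclidean norm. -/
abbrev UnitSphere (d : ℕ) : Type :=
  Metric.sphere (0 : EuclideanSpace ℂ (Fin d)) 1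

/-- The monomial `z ^ α = z₁ ^ α₁ ⋯ z_d ^ α_d`. -/
def monomialAt {d : ℕ} (α : Fin d → ℕ) (z : EuclideanSpace ℂ (Fin d)) : ℂ :=
  ∏ j, z j ^ α j

/-- The moment kernel of a measure on the unit sphere of `ℂ ^ d`. The integrand is continuous and
bounded, so it is integrable whenever the measure is finite. -/
noncomputable def momentKernel {d : ℕ} (μ : Measure (UnitSphere d)) (α β : Fin d → ℕ) : ℂ :=
  ∫ ζ : UnitSphere d, monomialAt α ζ * conj (monomialAt β ζ) ∂μ

/-! Necessity is `∑ |ζ_j|² = 1` under the integral. For sufficiency (`d = e + 1`), positivity of `K`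
supplies nonnegative densities. With `v_α(ζ) = w(|α|) ζ^α / α!` and `w(k) = √(k! (k+e)!)`, the form
`∑ conj(v_α) K(α,β) v_β` over degrees below `M` is nonnegative at each `ζ`. Divided by `M`, it is a
density with respect to a multiple `σ` of surface measure.

Its moments are explicit. Orthogonality of monomials in `L²(σ)` forces `γ + β = δ + α`, and
Vandermonde's identity expands `(γ+β)! / (α! β!)` over multi-indices `s ≤ γ, δ`. In the `s`-term, `α
= γ - s + τ` and `β = δ - s + τ`. The recurrence, iterated through the multinomial theorem, then
collapses the sum over `|τ| = t` to a multiple of `K(γ-s, δ-s)`. The choice of `w` makes the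
multiplier asymptotic to `t^(-|s|)`, so averaging over `t` leaves only `s = 0`, that is, `K(γ,δ)`.
The moments thus converge to `K`, and compactness of measures of bounded mass on the sphere gives
the representing measure. -/

/-! ### Limits of moments by weak compactness -/

/-- If the integrals of a family of continuous functions containing `1` against a sequence of finite
measures on a compact space converge, then the limits are the integrals against some finite
measure. -/
theorem exists_isFiniteMeasure_integral_eq_of_tendsto {X ι : Type*} [TopologicalSpace X]
    [CompactSpace X] [T2Space X] [MeasurableSpace X] [BorelSpace X]
    [HasOuterApproxClosed X] (μ : ℕ → Measure X) [∀ n, IsFiniteMeasure (μ n)]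
    (φ : ι → C(X, ℂ)) (m : ι → ℂ) (i₀ : ι) (hi₀ : φ i₀ = 1)
    (h : ∀ i, Filter.Tendsto (fun n ↦ ∫ x, φ i x ∂(μ n)) Filter.atTop (nhds (m i))) :
    ∃ ν : Measure X, IsFiniteMeasure ν ∧ ∀ i, m i = ∫ x, φ i x ∂ν := by
  let F : ℕ → FiniteMeasure X := fun n ↦ ⟨μ n, inferInstance⟩
  have hmass : ∀ n, (∫ x, φ i₀ x ∂(μ n)).re = (F n).mass := by
    intro n
    simp only [hi₀, ContinuousMap.one_apply]
    simp [F, FiniteMeasure.mass, Measure.real]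
    rfl
  -- The integrals of `φ i₀ = 1` are the masses; they converge, hence are bounded.
  obtain ⟨C, hC⟩ : ∃ C : NNReal, ∀ n, (F n).mass ≤ C := by
    obtain ⟨C, hC⟩ := ((Complex.continuous_re.tendsto _).comp (h i₀)).bddAbove_range
    refine ⟨C.toNNReal, fun n ↦ ?_⟩
    have := hC ⟨n, rfl⟩
    simp only [Function.comp_apply, hmass] at this
    exact NNReal.le_toNNReal_of_coe_le this
  obtain ⟨ν, -, hν⟩ := (isCompact_setOfPred_finiteMeasure_le_of_compactSpace X C)
    (f := Filter.map F Filter.atTop) (by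
      rw [Filter.le_principal_iff, Filter.mem_map]
      exact Filter.univ_mem' hC)
  refine ⟨ν, inferInstance, fun i ↦ ?_⟩
  -- A cluster point suffices: a convergent sequence of integrals has only its limit as cluster
  -- value.
  have key : ∀ g : C(X, ℝ), ∀ l : ℝ,
      Filter.Tendsto (fun n ↦ ∫ x, g x ∂(μ n)) Filter.atTop (nhds l) → l = ∫ x, g x ∂ν := by
    intro g l hl
    have hcont : Continuous fun ρ : FiniteMeasure X ↦ ∫ x, g x ∂(ρ : Measure X) :=
      FiniteMeasure.continuous_integral_boundedContinuousFunction
        (BoundedContinuousFunction.mkOfCompact g)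
    have h1 : MapClusterPt (∫ x, g x ∂(ν : Measure X)) Filter.atTop
        (fun n ↦ ∫ x, g x ∂(μ n)) :=
      MapClusterPt.continuousAt_comp (f := fun ρ : FiniteMeasure X ↦ ∫ x, g x ∂(ρ : Measure X))
        hcont.continuousAt hν
    have h2 : ClusterPt (∫ x, g x ∂(ν : Measure X)) (nhds l) := ClusterPt.mono h1 hl
    exact (eq_of_nhds_neBot h2).symm
  have hint : ∀ (ρ : Measure X) [IsFiniteMeasure ρ], Integrable (fun x ↦ φ i x) ρ := fun ρ _ ↦
    (BoundedContinuousFunction.mkOfCompact (φ i)).integrable ρ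
  apply Complex.ext
  · rw [← RCLike.re_eq_complex_re, ← integral_re (hint ν)]
    refine key ⟨fun x ↦ (φ i x).re, by fun_prop⟩ _ ?_
    refine ((Complex.continuous_re.tendsto _).comp (h i)).congr fun n ↦ ?_
    exact (integral_re (hint (μ n))).symm
  · rw [← RCLike.im_eq_complex_im, ← integral_im (hint ν)]
    refine key ⟨fun x ↦ (φ i x).im, by fun_prop⟩ _ ?_
    refine ((Complex.continuous_im.tendsto _).comp (h i)).congr fun n ↦ ?_
    exact (integral_im (hint (μ n))).symm

/-! ### Integrals of monomials over the sphere -/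

theorem Complex.integral_pow_mul_conj_pow_mul_exp_neg_sq (a b : ℕ) :
    ∫ z : ℂ, z ^ a * conj z ^ b * (Real.exp (-‖z‖ ^ 2) : ℂ) =
      if a = b then (Real.pi * a.factorial : ℂ) else 0 := by
  split_ifs with hab
  · subst hab
    have h := Complex.integral_rpow_mul_exp_neg_rpow (p := 2) (q := 2 * a) (by norm_num)
      (by have : (0 : ℝ) ≤ a := a.cast_nonneg
          linarith)
    have h1 : ∀ z : ℂ, z ^ a * conj z ^ a * (Real.exp (-‖z‖ ^ 2) : ℂ) =
        ((‖z‖ ^ (2 * a : ℝ) * Real.exp (-‖z‖ ^ (2 : ℝ)) : ℝ) : ℂ) := by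
      intro z
      rw [← mul_pow, Complex.mul_conj, Complex.normSq_eq_norm_sq, Real.rpow_mul (norm_nonneg z)]
      norm_cast
    simp_rw [h1]
    rw [integral_complex_ofReal, h, show ((2 * a + 2) / 2 : ℝ) = a + 1 by ring,
      Real.Gamma_nat_eq_factorial]
    push_cast
    ring
  · set I := ∫ z : ℂ, z ^ a * conj z ^ b * (Real.exp (-‖z‖ ^ 2) : ℂ) with hI
    -- Rotation by the angle `π / (a - b)` preserves the measure and changes the sign of the
    -- integrand.
    let c : Circle := Circle.exp (Real.pi / (a - b))
    have hab' : (a - b : ℂ) ≠ 0 := sub_ne_zero.mpr (by exact_mod_cast hab)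
    have hc : (c : ℂ) ^ a * conj (c : ℂ) ^ b = -1 := by
      rw [← Circle.coe_inv_eq_conj, ← Circle.exp_neg, Circle.coe_exp, Circle.coe_exp,
        ← Complex.exp_nat_mul, ← Complex.exp_nat_mul, ← Complex.exp_add, ← Complex.exp_pi_mul_I]
      congr 1
      push_cast
      field_simp
      ring
    have h1 := (LinearIsometryEquiv.measurePreserving (rotation c)).integral_comp
      (rotation c).toHomeomorph.measurableEmbedding
      (fun z : ℂ ↦ z ^ a * conj z ^ b * (Real.exp (-‖z‖ ^ 2) : ℂ))
    have h2 : ∀ z : ℂ, (rotation c z) ^ a * conj (rotation c z) ^ b *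
        (Real.exp (-‖rotation c z‖ ^ 2) : ℂ) =
        -1 * (z ^ a * conj z ^ b * (Real.exp (-‖z‖ ^ 2) : ℂ)) := by
      intro z
      rw [LinearIsometryEquiv.norm_map, rotation_apply, map_mul, mul_pow, mul_pow, ← hc]
      ring
    simp_rw [h2] at h1
    rw [integral_const_mul, ← hI] at h1
    have h3 : I + I = 0 := by linear_combination -h1
    simpa using h3

theorem integral_monomialAt_mul_exp_neg_sq {d : ℕ} (α β : Fin d → ℕ) :
    ∫ z : Fin d → ℂ, (monomialAt α (WithLp.toLp 2 z) * conj (monomialAt β (WithLp.toLp 2 z))) *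
      (Real.exp (-‖WithLp.toLp 2 z‖ ^ 2) : ℂ) =
      if α = β then (Real.pi ^ d * ∏ j, ((α j).factorial : ℂ)) else 0 := by
  have h : ∀ z : Fin d → ℂ, (monomialAt α (WithLp.toLp 2 z) *
      conj (monomialAt β (WithLp.toLp 2 z))) * (Real.exp (-‖WithLp.toLp 2 z‖ ^ 2) : ℂ) =
      ∏ j, (z j ^ α j * conj (z j) ^ β j * (Real.exp (-‖z j‖ ^ 2) : ℂ)) := by
    intro z
    rw [Finset.prod_mul_distrib, Finset.prod_mul_distrib, EuclideanSpace.norm_sq_eq,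
      ← Finset.sum_neg_distrib, Real.exp_sum]
    simp [monomialAt]
  simp_rw [h]
  rw [integral_fintype_prod_volume_eq_prod
    (f := fun j (w : ℂ) ↦ w ^ α j * conj w ^ β j * (Real.exp (-‖w‖ ^ 2) : ℂ))]
  simp_rw [Complex.integral_pow_mul_conj_pow_mul_exp_neg_sq]
  split_ifs with hab
  · subst hab
    simp [Finset.prod_mul_distrib]
  · obtain ⟨j, hj⟩ := Function.ne_iff.mp hab
    exact Finset.prod_eq_zero (Finset.mem_univ j) (if_neg hj)

/-- In polar coordinates, homogeneity splits the integral into a spherical factor and a radial Gamma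
integral. -/
theorem integral_eq_integral_toSphere_mul {E : Type*} [NormedAddCommGroup E] [NormedSpace ℝ E]
    [MeasurableSpace E] [BorelSpace E] [FiniteDimensional ℝ E] [Nontrivial E] (μ : Measure E)
    [μ.IsAddHaarMeasure] (f : E → ℂ) (n : ℕ)
    (hf : ∀ (r : ℝ) (x : E), 0 < r → f (r • x) = (r : ℂ) ^ n * f x) :
    ∫ x, f x * (Real.exp (-‖x‖ ^ 2) : ℂ) ∂μ = (∫ ζ : Metric.sphere (0 : E) 1, f ζ ∂μ.toSphere) *
      ((1 / 2 * Real.Gamma ((Module.finrank ℝ E + n : ℝ) / 2) : ℝ) : ℂ) := by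
  have hpos : 0 < Module.finrank ℝ E := Module.finrank_pos
  calc
    _ = ∫ x : ({(0)}ᶜ : Set E), f x.1 * (Real.exp (-‖x.1‖ ^ 2) : ℂ) ∂(μ.comap (↑)) := by
      rw [integral_subtype_comap (measurableSet_singleton _).compl
        fun x ↦ f x * (Real.exp (-‖x‖ ^ 2) : ℂ), restrict_compl_singleton]
    _ = ∫ x : Metric.sphere (0 : E) 1 × Set.Ioi (0 : ℝ),
          f x.1 * (((x.2 : ℝ) ^ n * Real.exp (-(x.2 : ℝ) ^ 2) : ℝ) : ℂ)
          ∂μ.toSphere.prod (.volumeIoiPow (Module.finrank ℝ E - 1)) := by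
      rw [← μ.measurePreserving_homeomorphUnitSphereProd.integral_comp
        (Homeomorph.measurableEmbedding _)]
      refine integral_congr_ae (.of_forall fun x ↦ ?_)
      have hx : (0 : ℝ) < ‖x.1‖ := norm_pos_iff.mpr x.2
      simp only [homeomorphUnitSphereProd_apply_snd_coe, homeomorphUnitSphereProd_apply_fst_coe]
      have h := hf ‖x.1‖ (‖x.1‖⁻¹ • x.1) hx
      rw [smul_inv_smul₀ hx.ne'] at h
      rw [h]
      push_cast
      ring
    _ = (∫ ζ : Metric.sphere (0 : E) 1, f ζ ∂μ.toSphere) *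
        ∫ r : Set.Ioi (0 : ℝ), (((r : ℝ) ^ n * Real.exp (-(r : ℝ) ^ 2) : ℝ) : ℂ)
          ∂.volumeIoiPow (Module.finrank ℝ E - 1) :=
      integral_prod_mul (fun ζ : Metric.sphere (0 : E) 1 ↦ f ζ)
        (fun r : Set.Ioi (0 : ℝ) ↦ (((r : ℝ) ^ n * Real.exp (-(r : ℝ) ^ 2) : ℝ) : ℂ))
    _ = _ := by
      congr 1
      rw [integral_complex_ofReal]
      congr 1
      simp only [Measure.volumeIoiPow, ENNReal.ofReal]
      rw [integral_withDensity_eq_integral_smul, integral_subtype_comap measurableSet_Ioi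
          fun a ↦ Real.toNNReal (a ^ (Module.finrank ℝ E - 1)) • (a ^ n * Real.exp (-a ^ 2))]
      · have h := integral_rpow_mul_exp_neg_rpow (p := 2) (q := (Module.finrank ℝ E - 1 + n : ℕ))
          (by norm_num) (by
            have : (0 : ℝ) ≤ (Module.finrank ℝ E - 1 + n : ℕ) := Nat.cast_nonneg _
            linarith)
        rw [show ((Module.finrank ℝ E + n : ℝ) / 2) =
          (((Module.finrank ℝ E - 1 + n : ℕ) : ℝ) + 1) / 2 by
            rw [Nat.cast_add, Nat.cast_pred hpos]; ring, ← h]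
        refine setIntegral_congr_fun measurableSet_Ioi fun x hx ↦ ?_
        rw [NNReal.smul_def, Real.coe_toNNReal _ (pow_nonneg (Set.mem_Ioi.mp hx).le _),
          Real.rpow_natCast, pow_add, Real.rpow_two, smul_eq_mul, mul_assoc]
      · exact (measurable_subtype_coe.pow_const _).real_toNNReal

theorem monomialAt_smul {d : ℕ} (α : Fin d → ℕ) (r : ℝ) (z : EuclideanSpace ℂ (Fin d)) :
    monomialAt α (r • z) = (r : ℂ) ^ (∑ j, α j) * monomialAt α z := by
  simp [monomialAt, mul_pow, Finset.prod_mul_distrib, Finset.prod_pow_eq_pow_sum]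

/-- The Gaussian integral of a monomial is computed twice, as a product over coordinates and in
polar coordinates; comparison gives the spherical integral. -/
theorem exists_measure_integral_monomialAt (d : ℕ) (hd : 0 < d) :
    ∃ σ : Measure (UnitSphere d), IsFiniteMeasure σ ∧ ∀ α β : Fin d → ℕ,
      ∫ ζ : UnitSphere d, monomialAt α ζ * conj (monomialAt β ζ) ∂σ =
      if α = β then (((∏ j, ((α j).factorial : ℝ)) / ((∑ j, α j) + d - 1).factorial : ℝ) : ℂ)
      else 0 := by
  have : Nonempty (Fin d) := ⟨⟨0, hd⟩⟩
  have : Nontrivial (EuclideanSpace ℂ (Fin d)) := inferInstance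
  let e : (Fin d → ℂ) ≃L[ℝ] EuclideanSpace ℂ (Fin d) :=
    (PiLp.continuousLinearEquiv 2 ℝ fun _ : Fin d ↦ ℂ).symm
  let μ : Measure (EuclideanSpace ℂ (Fin d)) := Measure.map e volume
  have : μ.IsAddHaarMeasure := e.isAddHaarMeasure_map volume
  have hfin : Module.finrank ℝ (EuclideanSpace ℂ (Fin d)) = 2 * d := by
    rw [← e.toLinearEquiv.finrank_eq]
    rw [Module.finrank_pi_fintype]
    simp [mul_comm]
  have key : ∀ α β : Fin d → ℕ,
      (∫ ζ : UnitSphere d, monomialAt α ζ * conj (monomialAt β ζ) ∂μ.toSphere) *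
      ((1 / 2 * Real.Gamma ((2 * d + (∑ j, α j + ∑ j, β j : ℕ) : ℝ) / 2) : ℝ) : ℂ) =
      if α = β then (Real.pi ^ d * ∏ j, ((α j).factorial : ℂ)) else 0 := by
    intro α β
    rw [← integral_monomialAt_mul_exp_neg_sq]
    have h := integral_eq_integral_toSphere_mul μ
      (fun z ↦ monomialAt α z * conj (monomialAt β z)) (∑ j, α j + ∑ j, β j) fun r x _ ↦ by
        simp only [monomialAt_smul, map_mul, map_pow, Complex.conj_ofReal]
        ring
    rw [hfin] at h
    push_cast at h ⊢
    rw [← h]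
    exact e.toHomeomorph.measurableEmbedding.integral_map _
  -- This factor cancels `π ^ d` from the Gaussian integrals and `1 / 2` from the radial one.
  refine ⟨(1 / (2 * Real.pi ^ d)).toNNReal • μ.toSphere, inferInstance, fun α β ↦ ?_⟩
  rw [integral_smul_nnreal_measure, NNReal.smul_def, Real.coe_toNNReal _ (by positivity)]
  have h := key α β
  split_ifs at h ⊢ with hab
  · subst hab
    have h1 : ((2 * d + (∑ j, α j + ∑ j, α j : ℕ) : ℝ) / 2) =
        (((∑ j, α j) + d - 1 : ℕ) : ℝ) + 1 := by
      rw [Nat.cast_pred (by omega)]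
      push_cast
      ring
    rw [h1, Real.Gamma_nat_eq_factorial] at h
    have h2 : ((((∑ j, α j) + d - 1).factorial : ℕ) : ℂ) ≠ 0 := by
      exact_mod_cast Nat.factorial_ne_zero _
    have h3 : (Real.pi : ℂ) ≠ 0 := by exact_mod_cast Real.pi_ne_zero
    rw [Complex.real_smul]
    push_cast at h ⊢
    rw [eq_div_iff h2]
    field_simp
    linear_combination 2 * h
  · have h1 : ((1 / 2 * Real.Gamma ((2 * d + (∑ j, α j + ∑ j, β j : ℕ) : ℝ) / 2) : ℝ) : ℂ) ≠ 0 := by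
      have : (0 : ℝ) < (2 * d + (∑ j, α j + ∑ j, β j : ℕ) : ℝ) / 2 := by positivity
      have := Real.Gamma_pos_of_pos this
      exact_mod_cast (by positivity : 1 / 2 *
        Real.Gamma ((2 * d + (∑ j, α j + ∑ j, β j : ℕ) : ℝ) / 2) ≠ 0)
    rw [(mul_eq_zero.mp h).resolve_right h1, smul_zero]

/-! ### Vandermonde and multinomial identities -/

/-- Since `(c + b)! = a! e! C(c + b, e)`, this is Vandermonde's expansion of `C(c + b, e)`. The
condition `c ≤ a + s` says `e - s ≤ b`. -/
theorem factorial_div_eq_sum (a b c e : ℕ) (h : c + b = e + a) :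
    ((c + b).factorial : ℝ) / (a.factorial * b.factorial) =
      ∑ s ∈ Finset.range (min c e + 1), (s.factorial * c.choose s * e.choose s : ℝ) *
        if c ≤ a + s then ((a + s - c).factorial : ℝ)⁻¹ else 0 := by
  have h1 : ((c + b).factorial : ℝ) = a.factorial * e.factorial * (c + b).choose e := by
    rw [h, ← Nat.add_choose_mul_factorial_mul_factorial e a, Nat.choose_symm_add]
    push_cast
    ring
  have h2 : ((c + b).choose e : ℝ) =
      ∑ s ∈ Finset.range (e + 1), (c.choose s : ℝ) * b.choose (e - s) := by
    rw [Nat.add_choose_eq, Finset.Nat.sum_antidiagonal_eq_sum_range_succ_mk]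
    push_cast
    rfl
  have h3 : ∑ s ∈ Finset.range (min c e + 1), (s.factorial * c.choose s * e.choose s : ℝ) *
        (if c ≤ a + s then ((a + s - c).factorial : ℝ)⁻¹ else 0) =
      ∑ s ∈ Finset.range (e + 1), (s.factorial * c.choose s * e.choose s : ℝ) *
        (if c ≤ a + s then ((a + s - c).factorial : ℝ)⁻¹ else 0) := by
    refine Finset.sum_subset (fun s ↦ by simp) fun s hs hs' ↦ ?_
    simp only [Finset.mem_range] at hs hs'
    rw [Nat.choose_eq_zero_of_lt (show c < s by omega)]
    simp
  rw [h3, h1, h2, Finset.mul_sum, Finset.sum_div]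
  refine Finset.sum_congr rfl fun s hs ↦ ?_
  have hs : s ≤ e := by simp at hs; omega
  have h4 : (e.factorial : ℝ) = e.choose s * s.factorial * (e - s).factorial := by
    rw [← Nat.choose_mul_factorial_mul_factorial hs]; push_cast; ring
  by_cases hc : c ≤ a + s
  · have hb : e - s ≤ b := by omega
    have h5 : (b.factorial : ℝ) = b.choose (e - s) * (e - s).factorial * (a + s - c).factorial := by
      rw [← Nat.choose_mul_factorial_mul_factorial hb, show b - (e - s) = a + s - c by omega]
      push_cast; ring
    have h6 : (b.choose (e - s) : ℝ) ≠ 0 := by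
      exact_mod_cast (Nat.choose_pos hb).ne'
    rw [if_pos hc, h5, h4]
    field_simp
  · rw [if_neg hc, Nat.choose_eq_zero_of_lt (show b < e - s by omega)]
    simp

theorem prod_factorial_div_eq_sum {d : ℕ} (α β γ δ : Fin d → ℕ) (h : γ + β = δ + α) :
    (∏ j, ((γ + β) j).factorial : ℝ) / ((∏ j, ((α j).factorial : ℝ)) * ∏ j, ((β j).factorial : ℝ)) =
      ∑ s ∈ Fintype.piFinset fun j ↦ Finset.range (min (γ j) (δ j) + 1),
        (∏ j, ((s j).factorial * (γ j).choose (s j) * (δ j).choose (s j) : ℝ)) *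
        if ∀ j, γ j ≤ α j + s j then (∏ j, ((α + s - γ) j).factorial : ℝ)⁻¹ else 0 := by
  rw [← Finset.prod_mul_distrib, ← Finset.prod_div_distrib]
  simp only [Pi.add_apply]
  rw [Finset.prod_congr rfl fun j _ ↦ factorial_div_eq_sum (α j) (β j) (γ j) (δ j) (congrFun h j),
    Finset.prod_univ_sum]
  refine Finset.sum_congr rfl fun s _ ↦ ?_
  rw [Finset.prod_mul_distrib]
  congr 1
  by_cases hc : ∀ j, γ j ≤ α j + s j
  · rw [if_pos hc, ← Finset.prod_inv_distrib]
    exact Finset.prod_congr rfl fun j _ ↦ if_pos (hc j)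
  · rw [if_neg hc]
    push Not at hc
    obtain ⟨j, hj⟩ := hc
    exact Finset.prod_eq_zero (Finset.mem_univ j) (if_neg (not_le.mpr hj))

/-- Let `Λ` be the linear functional on polynomials sending `X^τ` to `K (α + τ) (β + τ)`. The
recurrence says that `Λ` is unchanged by multiplication by `∑ X_j`, so `Λ ((∑ X_j)^t) = K α β`; the
multinomial theorem expands the left side. -/
theorem sum_piAntidiag_inv_factorial_mul {d : ℕ} (K : (Fin d → ℕ) → (Fin d → ℕ) → ℂ)
    (hK : ∀ α β, K α β = ∑ j : Fin d, K (α + Pi.single j 1) (β + Pi.single j 1))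
    (α β : Fin d → ℕ) (t : ℕ) :
    ∑ τ ∈ Finset.piAntidiag Finset.univ t, ((∏ j, (τ j).factorial : ℝ)⁻¹ : ℝ) *
      K (α + τ) (β + τ) = ((t.factorial : ℝ)⁻¹ : ℝ) * K α β := by
  let Λ : MvPolynomial (Fin d) ℂ →ₗ[ℂ] ℂ :=
    (MvPolynomial.basisMonomials (Fin d) ℂ).constr ℂ fun τ ↦ K (α + τ) (β + τ)
  have hΛ : ∀ τ : Fin d →₀ ℕ, Λ (MvPolynomial.monomial τ 1) = K (α + τ) (β + τ) := fun τ ↦ by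
    have := (MvPolynomial.basisMonomials (Fin d) ℂ).constr_basis ℂ (fun τ ↦ K (α + τ) (β + τ)) τ
    rwa [MvPolynomial.coe_basisMonomials] at this
  have hmul : Λ ∘ₗ LinearMap.mulRight ℂ (∑ j, MvPolynomial.X j) = Λ := by
    refine (MvPolynomial.basisMonomials (Fin d) ℂ).ext fun τ ↦ ?_
    simp only [MvPolynomial.coe_basisMonomials, LinearMap.comp_apply, LinearMap.mulRight_apply,
      Finset.mul_sum, map_sum, MvPolynomial.X, MvPolynomial.monomial_mul, mul_one, hΛ]
    rw [hK (α + τ) (β + τ)]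
    refine Finset.sum_congr rfl fun j _ ↦ ?_
    rw [Finsupp.coe_add, Finsupp.single_eq_pi_single, add_assoc, add_assoc]
  have hpow : ∀ n : ℕ, Λ ((∑ j, MvPolynomial.X j) ^ n) = K α β := by
    intro n
    induction n with
    | zero => simpa using hΛ 0
    | succ n ih => rw [pow_succ, ← ih]; exact LinearMap.congr_fun hmul _
  rw [← hpow t, Finset.sum_pow_eq_sum_piAntidiag, map_sum, Finset.mul_sum]
  refine Finset.sum_congr rfl fun τ hτ ↦ ?_
  have hτ' : ∑ j, τ j = t := by simpa using hτ
  have h1 : (∏ j, MvPolynomial.X j ^ τ j : MvPolynomial (Fin d) ℂ) =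
      MvPolynomial.monomial (Finsupp.equivFunOnFinite.symm τ) 1 := by
    rw [MvPolynomial.monomial_eq]
    simp [Finsupp.prod_fintype]
  have h2 := Nat.multinomial_spec Finset.univ τ
  rw [hτ'] at h2
  have h3 : ((∏ j, (τ j).factorial : ℕ) : ℂ) ≠ 0 := by
    exact_mod_cast (Finset.prod_pos fun j _ ↦ Nat.factorial_pos _).ne'
  rw [h1, ← nsmul_eq_mul, map_nsmul, hΛ, nsmul_eq_mul, ← h2]
  have h4 : ((Nat.multinomial Finset.univ τ : ℕ) : ℂ) ≠ 0 := by
    exact_mod_cast (Nat.multinomial_pos _ _).ne'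
  push_cast at h3 ⊢
  simp only [Finsupp.coe_equivFunOnFinite_symm]
  field_simp

/-! ### Asymptotics of the weights and Cesàro means -/

theorem tendsto_add_factorial_div (a : ℕ) :
    Filter.Tendsto (fun t : ℕ ↦ ((t + a).factorial : ℝ) / (t.factorial * (t : ℝ) ^ a))
      Filter.atTop (nhds 1) := by
  induction a with
  | zero => simp [Nat.factorial_ne_zero]
  | succ a ih =>
    have h1 : Filter.Tendsto (fun t : ℕ ↦ 1 + ((a : ℝ) + 1) / (t : ℝ)) Filter.atTop (nhds 1) := by
      simpa using (tendsto_const_div_atTop_nhds_zero_nat ((a : ℝ) + 1)).const_add 1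
    refine Filter.Tendsto.congr' ?_ (by simpa using ih.mul h1)
    filter_upwards [Filter.eventually_gt_atTop 0] with t ht
    have : (t : ℝ) ≠ 0 := by exact_mod_cast ht.ne'
    rw [← add_assoc, Nat.factorial_succ]
    push_cast
    field_simp
    ring

/-- The weight `√(k! (k + e)!)` of the monomials of degree `k` in the coherent vectors used to
approximate a representing measure on the unit sphere of `ℂ ^ (e + 1)`. -/
noncomputable def sphereWeight (e k : ℕ) : ℝ :=
  √(k.factorial * (k + e).factorial)

/-- As `(t + a)! ~ t! t^a`, the numerator is asymptotic to `t!² t^(g+h+e)` and the denominator to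
`t!² t^(s+g+h+e)`. -/
theorem tendsto_sphereWeight_mul_div (e g h s : ℕ) :
    Filter.Tendsto (fun t : ℕ ↦ sphereWeight e (g + t) * sphereWeight e (h + t) /
      ((s + g + (h + t) + e).factorial * t.factorial : ℝ)) Filter.atTop
      (nhds (if s = 0 then 1 else 0)) := by
  let b : ℕ → ℕ → ℝ := fun a t ↦ ((t + a).factorial : ℝ) / (t.factorial * (t : ℝ) ^ a)
  have hb : ∀ a, Filter.Tendsto (b a) Filter.atTop (nhds 1) := tendsto_add_factorial_div
  have hpow : Filter.Tendsto (fun t : ℕ ↦ ((t : ℝ)⁻¹) ^ s) Filter.atTop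
      (nhds (if s = 0 then 1 else 0)) := by
    split_ifs with hs
    · simp [hs]
    · simpa [hs] using (tendsto_inv_atTop_nhds_zero_nat (𝕜 := ℝ)).pow s
  have hlim : Filter.Tendsto (fun t : ℕ ↦ √(b g t * b (g + e) t * (b h t * b (h + e) t)) /
      b (s + g + h + e) t * ((t : ℝ)⁻¹) ^ s) Filter.atTop (nhds (if s = 0 then 1 else 0)) := by
    simpa using ((((hb g).mul (hb (g + e))).mul ((hb h).mul (hb (h + e)))).sqrt.div
      (hb (s + g + h + e)) one_ne_zero).mul hpow
  refine hlim.congr' ?_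
  filter_upwards [Filter.eventually_gt_atTop 0] with t ht
  have ht0 : (0 : ℝ) < t := by exact_mod_cast ht
  have hb' : ∀ a, ((t + a).factorial : ℝ) = b a t * (t.factorial * (t : ℝ) ^ a) := by
    intro a
    have : (t.factorial : ℝ) ≠ 0 := by exact_mod_cast Nat.factorial_ne_zero _
    simp only [b]
    field_simp
  have hpos : 0 < b (s + g + h + e) t := by
    simp only [b]
    positivity
  rw [sphereWeight, sphereWeight, ← Real.sqrt_mul (by positivity), add_comm g t, add_comm h t,
    show s + g + (t + h) + e = t + (s + g + h + e) by ring, add_assoc t g, add_assoc t h,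
    hb' g, hb' (g + e), hb' h, hb' (h + e), hb' (s + g + h + e),
    show b g t * (t.factorial * (t : ℝ) ^ g) * (b (g + e) t * (t.factorial * (t : ℝ) ^ (g + e))) *
      (b h t * (t.factorial * (t : ℝ) ^ h) * (b (h + e) t * (t.factorial * (t : ℝ) ^ (h + e)))) =
      b g t * b (g + e) t * (b h t * b (h + e) t) *
        ((t.factorial : ℝ) ^ 2 * (t : ℝ) ^ (g + h + e)) ^ 2 by ring,
    Real.sqrt_mul' (b g t * b (g + e) t * (b h t * b (h + e) t)) (by positivity), Real.sqrt_sq (by positivity)]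
  have : (t.factorial : ℝ) ≠ 0 := by exact_mod_cast Nat.factorial_ne_zero _
  rw [inv_pow]
  field_simp
  ring

theorem Filter.Tendsto.inv_mul_sum_range_sub {u : ℕ → ℝ} {l : ℝ}
    (h : Filter.Tendsto u Filter.atTop (nhds l)) (q : ℕ) :
    Filter.Tendsto (fun M : ℕ ↦ (M : ℝ)⁻¹ * ∑ t ∈ Finset.range (M - q), u t)
      Filter.atTop (nhds l) := by
  rw [← Filter.tendsto_add_atTop_iff_nat q]
  have h1 : Filter.Tendsto (fun M : ℕ ↦ (M : ℝ) / (M + q)) Filter.atTop (nhds 1) :=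
    tendsto_natCast_div_add_atTop (q : ℝ)
  refine Filter.Tendsto.congr' ?_ (by simpa using h1.mul h.cesaro)
  filter_upwards [Filter.eventually_gt_atTop 0] with M hM
  have : (M : ℝ) ≠ 0 := by exact_mod_cast hM.ne'
  rw [Nat.add_sub_cancel]
  push_cast
  field_simp

/-! ### Sums over multi-indices of bounded degree -/

/-- The multi-indices of degree less than `M`. -/
def multiIndicesLT (d M : ℕ) : Finset (Fin d → ℕ) :=
  (Finset.range M).biUnion fun t ↦ Finset.piAntidiag Finset.univ t

theorem mem_multiIndicesLT {d M : ℕ} {α : Fin d → ℕ} :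
    α ∈ multiIndicesLT d M ↔ ∑ j, α j < M := by
  simp [multiIndicesLT]

theorem sum_multiIndicesLT {d M : ℕ} (f : (Fin d → ℕ) → ℂ) :
    ∑ α ∈ multiIndicesLT d M, f α =
      ∑ t ∈ Finset.range M, ∑ α ∈ Finset.piAntidiag Finset.univ t, f α := by
  refine Finset.sum_biUnion fun t _ t' _ htt' ↦ ?_
  rw [Function.onFun, Finset.disjoint_left]
  intro α h h'
  simp only [Finset.mem_piAntidiag] at h h'
  exact htt' (h.1.symm.trans h'.1)

/-- The surviving pairs are exactly `(γ + τ, δ + τ)`. Both degrees are below `M` precisely when `|τ|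
< M - max |γ| |δ|`; the truncated subtraction correctly gives an empty sum for small `M`. -/
theorem sum_multiIndicesLT_ite {d M : ℕ} (γ δ s : Fin d → ℕ) (f : (Fin d → ℕ) → (Fin d → ℕ) → ℂ) :
    ∑ α ∈ multiIndicesLT d M, ∑ β ∈ multiIndicesLT d M,
      (if s + γ + β = s + δ + α then
        (((if ∀ j, (s + γ) j ≤ α j + s j then
          (∏ j, ((α + s - (s + γ)) j).factorial : ℝ)⁻¹ else 0 : ℝ) : ℂ)) * f α β else 0) =
    ∑ τ ∈ multiIndicesLT d (M - max (∑ j, γ j) (∑ j, δ j)),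
      (((∏ j, (τ j).factorial : ℝ)⁻¹ : ℝ) : ℂ) * f (γ + τ) (δ + τ) := by
  have h1 : ∀ α β : Fin d → ℕ, (if s + γ + β = s + δ + α then
      (((if ∀ j, (s + γ) j ≤ α j + s j then
        (∏ j, ((α + s - (s + γ)) j).factorial : ℝ)⁻¹ else 0 : ℝ) : ℂ)) * f α β else 0) =
      if γ + β = δ + α ∧ ∀ j, γ j ≤ α j then
        (((∏ j, ((α - γ) j).factorial : ℝ)⁻¹ : ℝ) : ℂ) * f α β else 0 := by
    intro α β
    have h2 : (s + γ + β = s + δ + α) ↔ γ + β = δ + α := by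
      rw [add_assoc, add_assoc, add_right_inj]
    have h3 : (∀ j, (s + γ) j ≤ α j + s j) ↔ ∀ j, γ j ≤ α j := by
      simp only [Pi.add_apply]
      exact forall_congr' fun j ↦ by omega
    have h4 : α + s - (s + γ) = α - γ := by
      funext j
      simp only [Pi.add_apply, Pi.sub_apply]
      omega
    simp only [h2, h3, h4]
    by_cases hd : γ + β = δ + α <;> by_cases hle : ∀ j, γ j ≤ α j <;> simp [hd, hle]
  simp only [h1]
  rw [← Finset.sum_product', ← Finset.sum_filter]
  symm
  refine Finset.sum_nbij' (fun τ ↦ (γ + τ, δ + τ)) (fun p ↦ p.1 - γ) ?_ ?_ ?_ ?_ ?_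
  · intro τ hτ
    rw [mem_multiIndicesLT] at hτ
    simp only [Finset.mem_filter, Finset.mem_product, mem_multiIndicesLT, Pi.add_apply,
      Finset.sum_add_distrib]
    refine ⟨⟨by omega, by omega⟩, by abel, fun j ↦ by simp⟩
  · rintro ⟨α, β⟩ h
    simp only [Finset.mem_filter, Finset.mem_product, mem_multiIndicesLT] at h ⊢
    obtain ⟨⟨hα, hβ⟩, h, hle⟩ := h
    obtain ⟨τ, rfl⟩ := exists_add_of_le (show γ ≤ α from hle)
    obtain rfl : β = δ + τ := by
      apply add_left_cancel (a := γ)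
      rw [h]
      abel
    simp only [add_tsub_cancel_left]
    simp only [Pi.add_apply, Finset.sum_add_distrib] at hα hβ
    omega
  · intro τ _
    exact add_tsub_cancel_left _ _
  · rintro ⟨α, β⟩ h
    simp only [Finset.mem_filter] at h
    obtain ⟨_, h, hle⟩ := h
    obtain ⟨τ, rfl⟩ := exists_add_of_le (show γ ≤ α from hle)
    obtain rfl : β = δ + τ := by
      apply add_left_cancel (a := γ)
      rw [h]
      abel
    simp
  · intro τ _
    simp

theorem sum_multiIndicesLT_sphereWeight {d : ℕ} (K : (Fin d → ℕ) → (Fin d → ℕ) → ℂ)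
    (hK : ∀ α β, K α β = ∑ j : Fin d, K (α + Pi.single j 1) (β + Pi.single j 1))
    (e n N : ℕ) (γ δ : Fin d → ℕ) :
    ∑ τ ∈ multiIndicesLT d N, (((∏ j, (τ j).factorial : ℝ)⁻¹ : ℝ) : ℂ) *
      (((sphereWeight e (∑ j, (γ + τ) j) * sphereWeight e (∑ j, (δ + τ) j) /
        (n + ∑ j, (δ + τ) j + e).factorial : ℝ) : ℂ) * K (γ + τ) (δ + τ)) =
    ((∑ t ∈ Finset.range N, sphereWeight e (∑ j, γ j + t) * sphereWeight e (∑ j, δ j + t) /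
      ((n + (∑ j, δ j + t) + e).factorial * t.factorial : ℝ) : ℝ) : ℂ) * K γ δ := by
  rw [sum_multiIndicesLT, Complex.ofReal_sum, Finset.sum_mul]
  refine Finset.sum_congr rfl fun t _ ↦ ?_
  have h1 : ∀ τ ∈ Finset.piAntidiag (Finset.univ : Finset (Fin d)) t,
      (((∏ j, (τ j).factorial : ℝ)⁻¹ : ℝ) : ℂ) *
      (((sphereWeight e (∑ j, (γ + τ) j) * sphereWeight e (∑ j, (δ + τ) j) /
        (n + ∑ j, (δ + τ) j + e).factorial : ℝ) : ℂ) * K (γ + τ) (δ + τ)) =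
      ((sphereWeight e (∑ j, γ j + t) * sphereWeight e (∑ j, δ j + t) /
        (n + (∑ j, δ j + t) + e).factorial : ℝ) : ℂ) *
      ((((∏ j, (τ j).factorial : ℝ)⁻¹ : ℝ) : ℂ) * K (γ + τ) (δ + τ)) := by
    intro τ hτ
    have hτ' : ∑ j, τ j = t := by simpa using hτ
    simp only [Pi.add_apply, Finset.sum_add_distrib, hτ']
    ring
  rw [Finset.sum_congr rfl h1, ← Finset.mul_sum, sum_piAntidiag_inv_factorial_mul K hK,
    ← mul_assoc, ← Complex.ofReal_mul]
  congr 2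
  rw [← div_eq_mul_inv, div_div]

/-! ### Coherent vectors and the moments of their densities -/

theorem monomialAt_add {d : ℕ} (α β : Fin d → ℕ) (z : EuclideanSpace ℂ (Fin d)) :
    monomialAt (α + β) z = monomialAt α z * monomialAt β z := by
  simp [monomialAt, pow_add, Finset.prod_mul_distrib]

@[fun_prop]
theorem continuous_monomialAt {d : ℕ} (α : Fin d → ℕ) :
    Continuous (monomialAt α : EuclideanSpace ℂ (Fin d) → ℂ) := by
  unfold monomialAt
  fun_prop

/-- The coefficient at the multi-index `α` of the coherent vectors. -/
noncomputable def coherentCoeff {d : ℕ} (e : ℕ) (α : Fin d → ℕ) : ℝ :=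
  sphereWeight e (∑ j, α j) / ∏ j, ((α j).factorial : ℝ)

/-- The value of the quadratic form of the kernel `K` at the coherent vector attached to `z`,
truncated at degree `M`. -/
noncomputable def coherentForm {d : ℕ} (K : (Fin d → ℕ) → (Fin d → ℕ) → ℂ) (e M : ℕ)
    (z : EuclideanSpace ℂ (Fin d)) : ℂ :=
  ∑ α ∈ multiIndicesLT d M, ∑ β ∈ multiIndicesLT d M,
    conj (coherentCoeff e α * monomialAt α z) * K α β * (coherentCoeff e β * monomialAt β z)

theorem coherentForm_nonneg {d : ℕ} {K : (Fin d → ℕ) → (Fin d → ℕ) → ℂ} (hK : IsPositiveKernel K)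
    (e M : ℕ) (z : EuclideanSpace ℂ (Fin d)) : 0 ≤ coherentForm K e M z := by
  classical
  let x : (Fin d → ℕ) →₀ ℂ := Finsupp.onFinset (multiIndicesLT d M)
    (fun α ↦ if α ∈ multiIndicesLT d M then coherentCoeff e α * monomialAt α z else 0)
    fun α h ↦ by by_contra h'; simp [h'] at h
  have h := hK.2 x
  have h1 : x.support ⊆ multiIndicesLT d M := Finsupp.support_onFinset_subset
  have h2 : ∀ α ∈ multiIndicesLT d M, x α = coherentCoeff e α * monomialAt α z := fun α hα ↦ by
    simp only [x, Finsupp.onFinset_apply, if_pos hα]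
  rw [Finsupp.sum_of_support_subset _ h1 _ (by simp)] at h
  rw [coherentForm]
  convert! h using 1
  refine Finset.sum_congr rfl fun α hα ↦ ?_
  rw [Finsupp.sum_of_support_subset _ h1 _ (by simp)]
  refine Finset.sum_congr rfl fun β hβ ↦ ?_
  rw [h2 α hα, h2 β hβ]
  rfl

theorem continuous_coherentForm {d : ℕ} (K : (Fin d → ℕ) → (Fin d → ℕ) → ℂ) (e M : ℕ) :
    Continuous (coherentForm K e M) := by
  unfold coherentForm
  fun_prop

theorem integrable_of_continuous_unitSphere {d : ℕ} (σ : Measure (UnitSphere d))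
    [IsFiniteMeasure σ] {f : UnitSphere d → ℂ} (hf : Continuous f) : Integrable f σ :=
  (BoundedContinuousFunction.mkOfCompact ⟨f, hf⟩).integrable σ

theorem integral_monomialAt_mul_coherentForm {d e : ℕ} (K : (Fin d → ℕ) → (Fin d → ℕ) → ℂ)
    (hK : ∀ α β, K α β = ∑ j : Fin d, K (α + Pi.single j 1) (β + Pi.single j 1))
    (σ : Measure (UnitSphere d)) [IsFiniteMeasure σ]
    (hσ : ∀ α β : Fin d → ℕ, ∫ ζ : UnitSphere d, monomialAt α ζ * conj (monomialAt β ζ) ∂σ =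
      if α = β then (((∏ j, ((α j).factorial : ℝ)) / ((∑ j, α j) + e).factorial : ℝ) : ℂ)
      else 0) (M : ℕ) (γ δ : Fin d → ℕ) :
    ∫ ζ : UnitSphere d, monomialAt γ ζ * conj (monomialAt δ ζ) * coherentForm K e M ζ ∂σ =
      ∑ s ∈ Fintype.piFinset fun j ↦ Finset.range (min (γ j) (δ j) + 1),
        ((∏ j, ((s j).factorial * (γ j).choose (s j) * (δ j).choose (s j) : ℝ) : ℝ) : ℂ) *
        (((∑ t ∈ Finset.range (M - max (∑ j, (γ - s) j) (∑ j, (δ - s) j)),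
          sphereWeight e (∑ j, (γ - s) j + t) * sphereWeight e (∑ j, (δ - s) j + t) /
          ((∑ j, s j + ∑ j, (γ - s) j + (∑ j, (δ - s) j + t) + e).factorial *
            t.factorial : ℝ) : ℝ) : ℂ) * K (γ - s) (δ - s)) := by
  have h1 : ∀ ζ : UnitSphere d, monomialAt γ ζ * conj (monomialAt δ ζ) * coherentForm K e M ζ =
      ∑ α ∈ multiIndicesLT d M, ∑ β ∈ multiIndicesLT d M,
        (coherentCoeff e α * coherentCoeff e β * K α β) *
        (monomialAt (γ + β) ζ.1 * conj (monomialAt (δ + α) ζ.1)) := by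
    intro ζ
    simp only [coherentForm, Finset.mul_sum, monomialAt_add, map_mul, Complex.conj_ofReal]
    refine Finset.sum_congr rfl fun α _ ↦ Finset.sum_congr rfl fun β _ ↦ ?_
    ring
  have h2 : ∫ ζ : UnitSphere d, monomialAt γ ζ * conj (monomialAt δ ζ) * coherentForm K e M ζ ∂σ =
      ∑ α ∈ multiIndicesLT d M, ∑ β ∈ multiIndicesLT d M,
        (coherentCoeff e α * coherentCoeff e β * K α β) *
        (if γ + β = δ + α then (((∏ j, (((γ + β) j).factorial : ℝ)) /
          ((∑ j, (γ + β) j) + e).factorial : ℝ) : ℂ) else 0) := by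
    simp only [h1]
    rw [integral_finsetSum _ fun α _ ↦ integrable_of_continuous_unitSphere σ (by fun_prop)]
    refine Finset.sum_congr rfl fun α _ ↦ ?_
    rw [integral_finsetSum _ fun β _ ↦ integrable_of_continuous_unitSphere σ (by fun_prop)]
    refine Finset.sum_congr rfl fun β _ ↦ ?_
    rw [integral_const_mul, hσ]
  let Φ : (Fin d → ℕ) → (Fin d → ℕ) → ℂ := fun α β ↦
    ((sphereWeight e (∑ j, α j) * sphereWeight e (∑ j, β j) /
      (∑ j, γ j + ∑ j, β j + e).factorial : ℝ) : ℂ) * K α β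
  have h3 : ∀ α β : Fin d → ℕ, (coherentCoeff e α * coherentCoeff e β * K α β) *
        (if γ + β = δ + α then (((∏ j, (((γ + β) j).factorial : ℝ)) /
          ((∑ j, (γ + β) j) + e).factorial : ℝ) : ℂ) else 0) =
      ∑ s ∈ Fintype.piFinset fun j ↦ Finset.range (min (γ j) (δ j) + 1),
        ((∏ j, ((s j).factorial * (γ j).choose (s j) * (δ j).choose (s j) : ℝ) : ℝ) : ℂ) *
        if γ + β = δ + α then
        (((if ∀ j, γ j ≤ α j + s j then
          (∏ j, ((α + s - γ) j).factorial : ℝ)⁻¹ else 0 : ℝ) : ℂ)) * Φ α β else 0 := by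
    intro α β
    split_ifs with h
    · have h4 := prod_factorial_div_eq_sum α β γ δ h
      calc _ = (((∏ j, ((γ + β) j).factorial : ℝ) / ((∏ j, ((α j).factorial : ℝ)) *
              ∏ j, ((β j).factorial : ℝ)) : ℝ) : ℂ) * Φ α β := by
            simp only [Φ, coherentCoeff, Pi.add_apply, Finset.sum_add_distrib]
            push_cast
            ring
        _ = _ := by
            rw [h4, Complex.ofReal_sum, Finset.sum_mul]
            refine Finset.sum_congr rfl fun s _ ↦ ?_
            rw [Complex.ofReal_mul, mul_assoc]
    · simp
  rw [h2]
  simp only [h3]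
  rw [Finset.sum_congr rfl fun α _ ↦ Finset.sum_comm, Finset.sum_comm]
  refine Finset.sum_congr rfl fun s hs ↦ ?_
  simp only [← Finset.mul_sum]
  congr 1
  simp only [Fintype.mem_piFinset, Finset.mem_range] at hs
  have hγ : s ≤ γ := fun j ↦ (Nat.lt_succ_iff.mp (hs j)).trans (min_le_left _ _)
  have hδ : s ≤ δ := fun j ↦ (Nat.lt_succ_iff.mp (hs j)).trans (min_le_right _ _)
  -- Writing `γ = s + γ'` and `δ = s + δ'` removes the subtractions before reindexing.
  obtain ⟨γ', rfl⟩ := exists_add_of_le hγ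
  obtain ⟨δ', rfl⟩ := exists_add_of_le hδ
  rw [sum_multiIndicesLT_ite, add_tsub_cancel_left, add_tsub_cancel_left,
    ← sum_multiIndicesLT_sphereWeight K hK]
  simp only [Φ, Pi.add_apply, Finset.sum_add_distrib]

/-! ### Existence of the representing measure -/

theorem exists_measure_eq_momentKernel {d : ℕ} (hd : 0 < d) (K : (Fin d → ℕ) → (Fin d → ℕ) → ℂ)
    (hK : IsPositiveKernel K)
    (h : ∀ α β, K α β = ∑ j : Fin d, K (α + Pi.single j 1) (β + Pi.single j 1)) :
    ∃ μ : Measure (UnitSphere d), IsFiniteMeasure μ ∧ ∀ α β, K α β = momentKernel μ α β := by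
  obtain ⟨σ, _, hσ⟩ := exists_measure_integral_monomialAt d hd
  obtain ⟨e, rfl⟩ : ∃ e, d = e + 1 := ⟨d - 1, by omega⟩
  have hσ' := integral_monomialAt_mul_coherentForm (e := e) K h σ hσ
  -- The factor `M⁻¹` turns the sum over degrees into a Cesàro mean.
  let ρ : ℕ → UnitSphere (e + 1) → ℝ := fun M ζ ↦ (M : ℝ)⁻¹ * (coherentForm K e M ζ).re
  have hρ0 : ∀ M ζ, 0 ≤ ρ M ζ := fun M ζ ↦
    mul_nonneg (by positivity) (Complex.le_def.mp (coherentForm_nonneg hK e M ζ)).1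
  have hρc : ∀ M, Continuous (ρ M) := fun M ↦ by
    have := continuous_coherentForm K e M
    fun_prop
  have hρ : ∀ M ζ, (ρ M ζ : ℂ) = (M : ℂ)⁻¹ * coherentForm K e M ζ := fun M ζ ↦ by
    have h0 := Complex.le_def.mp (coherentForm_nonneg hK e M ζ)
    have h1 : ((coherentForm K e M ζ).re : ℂ) = coherentForm K e M ζ :=
      Complex.ext (by simp) (by simpa using h0.2)
    simp only [ρ, Complex.ofReal_mul, h1]
    push_cast
    rfl
  let μ : ℕ → Measure (UnitSphere (e + 1)) := fun M ↦
    σ.withDensity fun ζ ↦ ENNReal.ofReal (ρ M ζ)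
  have hμ : ∀ M, IsFiniteMeasure (μ M) := fun M ↦
    isFiniteMeasure_withDensity_ofReal
      ((BoundedContinuousFunction.mkOfCompact ⟨ρ M, hρc M⟩).integrable σ).2
  let φ : (Fin (e + 1) → ℕ) × (Fin (e + 1) → ℕ) → C(UnitSphere (e + 1), ℂ) := fun p ↦
    ⟨fun ζ ↦ monomialAt p.1 ζ * conj (monomialAt p.2 ζ), by fun_prop⟩
  have hint : ∀ M p, ∫ ζ, φ p ζ ∂(μ M) = (M : ℂ)⁻¹ * ∫ ζ : UnitSphere (e + 1),
      monomialAt p.1 ζ * conj (monomialAt p.2 ζ) * coherentForm K e M ζ ∂σ := by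
    intro M p
    rw [integral_withDensity_eq_integral_toReal_smul (by have := hρc M; fun_prop) (by simp),
      ← integral_const_mul]
    refine integral_congr_ae (.of_forall fun ζ ↦ ?_)
    simp only [ENNReal.toReal_ofReal (hρ0 M ζ), Complex.real_smul, hρ, φ, ContinuousMap.coe_mk]
    ring
  suffices hlim : ∀ p, Filter.Tendsto (fun M ↦ ∫ ζ, φ p ζ ∂(μ M)) Filter.atTop
      (nhds (K p.1 p.2)) by
    obtain ⟨ν, hν, hνK⟩ := exists_isFiniteMeasure_integral_eq_of_tendsto μ φ
      (fun p ↦ K p.1 p.2) 0 (by ext; simp [φ, monomialAt]) hlim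
    exact ⟨ν, hν, fun α β ↦ hνK (α, β)⟩
  rintro ⟨γ, δ⟩
  simp only [hint, hσ', Finset.mul_sum]
  -- The limit is written as a sum over `s` with only `s = 0` contributing, so that convergence can
  -- be checked term by term.
  have hK0 : K γ δ = ∑ s ∈ Fintype.piFinset fun j ↦ Finset.range (min (γ j) (δ j) + 1),
      ((∏ j, ((s j).factorial * (γ j).choose (s j) * (δ j).choose (s j) : ℝ) : ℝ) : ℂ) *
        ((((if ∑ j, s j = 0 then 1 else 0 : ℝ) : ℝ) : ℂ) * K (γ - s) (δ - s)) := by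
    rw [Finset.sum_eq_single 0]
    · simp
    · intro s _ hs
      rw [if_neg (by simpa [funext_iff] using hs)]
      simp
    · intro h0
      simp at h0
  rw [hK0]
  refine tendsto_finsetSum _ fun s _ ↦ ?_
  have hlim := (tendsto_sphereWeight_mul_div e (∑ j, (γ - s) j) (∑ j, (δ - s) j)
    (∑ j, s j)).inv_mul_sum_range_sub (max (∑ j, (γ - s) j) (∑ j, (δ - s) j))
  have hlim' := (Complex.continuous_ofReal.tendsto _).comp hlim
  refine ((hlim'.mul_const (K (γ - s) (δ - s))).const_mul _).congr fun M ↦ ?_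
  simp only [Function.comp_apply]
  push_cast
  ring

/-! ### Necessity and the equivalence -/

theorem sum_norm_sq_unitSphere {d : ℕ} (ζ : UnitSphere d) :
    ∑ j, ζ.1 j * conj (ζ.1 j) = 1 := by
  have h := EuclideanSpace.norm_sq_eq ζ.1
  rw [norm_eq_of_mem_sphere] at h
  simp only [Complex.mul_conj, Complex.normSq_eq_norm_sq]
  exact_mod_cast (by rw [← h]; norm_num : ∑ j, ‖ζ.1 j‖ ^ 2 = 1)

theorem monomialAt_single {d : ℕ} (j : Fin d) (z : EuclideanSpace ℂ (Fin d)) :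
    monomialAt (Pi.single j 1) z = z j := by
  rw [monomialAt, Finset.prod_eq_single j] <;> simp +contextual

theorem momentKernel_eq_sum {d : ℕ} (μ : Measure (UnitSphere d)) [IsFiniteMeasure μ]
    (α β : Fin d → ℕ) : momentKernel μ α β =
      ∑ j : Fin d, momentKernel μ (α + Pi.single j 1) (β + Pi.single j 1) := by
  unfold momentKernel
  rw [← integral_finsetSum _ fun j _ ↦ integrable_of_continuous_unitSphere μ (by fun_prop)]
  refine integral_congr_ae (.of_forall fun ζ ↦ ?_)
  simp only [monomialAt_add, monomialAt_single, map_mul]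
  rw [← mul_one (monomialAt α ζ.1 * conj (monomialAt β ζ.1)), ← sum_norm_sq_unitSphere ζ,
    Finset.mul_sum]
  exact Finset.sum_congr rfl fun j _ ↦ by ring

theorem mainTheorem7 {d : ℕ} (K : (Fin d → ℕ) → (Fin d → ℕ) → ℂ) (hK : IsPositiveKernel K) :
    (∃ μ : Measure (UnitSphere d), IsFiniteMeasure μ ∧ ∀ α β, K α β = momentKernel μ α β) ↔
      ∀ α β, K α β = ∑ j : Fin d, K (α + Pi.single j 1) (β + Pi.single j 1) := by
  constructor
  · rintro ⟨μ, _, hμ⟩ α β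
    simp only [hμ]
    exact momentKernel_eq_sum μ α β
  · intro h
    rcases Nat.eq_zero_or_pos d with rfl | hd
    -- For `d = 0` the recurrence has an empty right side, so `K = 0` and the zero measure
    -- represents it.
    · exact ⟨0, inferInstance, fun α β ↦ by rw [h]; simp [momentKernel]⟩
    · exact exists_measure_eq_momentKernel hd K hK h
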